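/- Let $h_1,\dots,h_m,p\in\mathbb R[x]=\mathbb R[x_1,\dots,x_n]$ be such that $S=\{x\in\mathbb R^n: h_1(x)\ge 0,\dots,h_m(x)\ge 0\}$ is non-empty, let $\lambda^*=\inf\{p(x):x\in S\}$, and let $\lambda_{lb}\in\mathbb R$ satisfy $\lambda_{lb}\le\lambda^*$. Put $d_{\max}=\max\{\deg h_1,\dots,\deg h_m,\deg p\}$ (with $\deg 0:=0$), let $e$ be the all-ones vector, and let $\mathcal P_{d}(\mathbb R^{N}_+)$ be the set of real polynomials in $N$ variables of degree at most $d$ that are non-negative on the non-negative orthant $\mathbb R^N_+$ (copositive polynomials). For $\varepsilon>0$ let $\lambda_\varepsilon$ be the supremum of all $\lambda\in\mathbb R$ for which there is $F\in\mathcal P_{2d_{\max}}(\mathbb R^{2n+m+1}_+)$ such that, as polynomials in $(y,z)=(y_1,\dots,y_n,z_1,\dots,z_n)$, $$(1+e^\intercal y+e^\intercal z)^{2d_{\max}-\deg p}\bigl(p(y-z)-\lambda+\varepsilon(1+e^\intercal y+e^\intercal z)^{\deg p}\bigr)=F\bigl(y,z,h_1(y-z),\dots,h_m(y-z),p(y-z)-\lambda_{lb}\bigr).$$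 Then $\lambda_\varepsilon\ge\lambda^*$ for every $\varepsilon>0$, and $\lim_{\varepsilon\to0^+}\lambda_\varepsilon=\lambda^*$. Moreover, when $S\subseteq\mathbb R^n_+$ one can eliminate $z$ (set $z=0$): for every $\varepsilon>0$ the supremum of all $\lambda\in\mathbb R$ for which there is $F\in\mathcal P_{2d_{\max}}(\mathbb R^{n+m+1}_+)$ with $$(1+e^\intercal y)^{2d_{\max}-\deg p}\bigl(p(y)-\lambda+\varepsilon(1+e^\intercal y)^{\deg p}\bigr)=F\bigl(y,h_1(y),\dots,h_m(y),p(y)-\lambda_{lb}\bigr)$$ is equal to $\lambda_\varepsilon$; in particular it is at least $\lambda^*$ and tends to $\lambda^*$ as $\varepsilon\to0^+$. -/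

import Mathlib

open Filter Topology

noncomputable section

namespace CopositivePO

open MvPolynomial

/-- The non-negative orthant `ℝ^σ_+`. -/
def orthant (σ : Type) : Set (σ → ℝ) := {x | ∀ i, 0 ≤ x i}

/-- `𝒫_d(S)`: the polynomials of degree at most `d` that are non-negative on `S`. -/
def nonnegPolys {σ : Type} (d : ℕ) (S : Set (σ → ℝ)) : Set (MvPolynomial σ ℝ) :=
  {F | F.totalDegree ≤ d ∧ ∀ x ∈ S, 0 ≤ eval x F}

/-- The basic closed semialgebraic set `S = {x ∈ ℝⁿ : h₁(x) ≥ 0, …, h_m(x) ≥ 0}`. -/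
def semialgSet {n m : ℕ} (h : Fin m → MvPolynomial (Fin n) ℝ) : Set (Fin n → ℝ) :=
  {x | ∀ j, 0 ≤ eval x (h j)}

/-- The optimal value `λ* = inf {p(x) : x ∈ S}`, in the extended reals. -/
def optValue {n m : ℕ} (h : Fin m → MvPolynomial (Fin n) ℝ) (p : MvPolynomial (Fin n) ℝ) :
    EReal :=
  sInf ((fun x => ((eval x p : ℝ) : EReal)) '' semialgSet h)

/-- `d_max = max {deg h₁, …, deg h_m, deg p}`, where constants (and `0`) have degree `0`.
The term `deg p` is there because `p - λ_lb` is one of the constraints of the program below;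
it dominates `⌈deg p / 2⌉`. -/
def dMax {n m : ℕ} (h : Fin m → MvPolynomial (Fin n) ℝ) (p : MvPolynomial (Fin n) ℝ) : ℕ :=
  max (Finset.univ.sup fun j => (h j).totalDegree) p.totalDegree

/-- The affine form `1 + ∑ i, X i` in the variables indexed by `σ`. -/
def onePlusSum (σ : Type) [Fintype σ] : MvPolynomial σ ℝ := 1 + ∑ i, X i

/-- The arguments `h₁, …, h_m, p - λ_lb`. -/
def extConstraints {n m : ℕ} (h : Fin m → MvPolynomial (Fin n) ℝ)
    (p : MvPolynomial (Fin n) ℝ) (lb : ℝ) : Fin (m + 1) → MvPolynomial (Fin n) ℝ :=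
  Fin.snoc h (p - C lb)

/-- The set of `λ` that are feasible, together with some `F`, in the copositive program in
non-negative variables `w` indexed by `σ`, where `x` is replaced by the polynomials `θ(w)`:

`(1 + eᵀw)^(2 d_max - deg p) * (p(θ(w)) - λ + ε (1 + eᵀw)^(deg p))
    = F(w, h₁(θ(w)), …, h_m(θ(w)), p(θ(w)) - λ_lb)`,

with `F` copositive (non-negative on the orthant) of degree at most `2 d_max`.
The exponent `2 d_max - deg p` is a genuine difference since `deg p ≤ d_max`. -/
def copFeasible {n m : ℕ} {σ : Type} [Fintype σ] (θ : Fin n → MvPolynomial σ ℝ)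
    (h : Fin m → MvPolynomial (Fin n) ℝ) (p : MvPolynomial (Fin n) ℝ) (lb ε : ℝ) : Set ℝ :=
  {l | ∃ F ∈ nonnegPolys (2 * dMax h p) (orthant (σ ⊕ Fin (m + 1))),
    onePlusSum σ ^ (2 * dMax h p - p.totalDegree) *
        (bind₁ θ p - C l + C ε * onePlusSum σ ^ p.totalDegree) =
      bind₁ (Sum.elim X fun j => bind₁ θ (extConstraints h p lb j)) F}

/-- The supremum, in the extended reals, of the feasible `λ`. -/
def copSup {n m : ℕ} {σ : Type} [Fintype σ] (θ : Fin n → MvPolynomial σ ℝ)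
    (h : Fin m → MvPolynomial (Fin n) ℝ) (p : MvPolynomial (Fin n) ℝ) (lb ε : ℝ) : EReal :=
  sSup (Real.toEReal '' copFeasible θ h p lb ε)

/-- `λ_ε`: the variables are `(y, z)` and `x` is replaced by `y - z`, so that `F` has
`2n + m + 1` variables. -/
def copValue {n m : ℕ} (h : Fin m → MvPolynomial (Fin n) ℝ) (p : MvPolynomial (Fin n) ℝ)
    (lb ε : ℝ) : EReal :=
  copSup (σ := Fin n ⊕ Fin n) (fun i => X (Sum.inl i) - X (Sum.inr i)) h p lb ε

/-- The value of the program from which `z` is eliminated (`z = 0`): the variables are `y` and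
`x` is replaced by `y`, so that `F` has `n + m + 1` variables. -/
def copValueNoZ {n m : ℕ} (h : Fin m → MvPolynomial (Fin n) ℝ) (p : MvPolynomial (Fin n) ℝ)
    (lb ε : ℝ) : EReal :=
  copSup (σ := Fin n) (fun i => X i) h p lb ε

end CopositivePO

end

/-!
The value of the copositive program can be computed exactly: for a substitution `θ` by linear forms
it is the infimum of `p (θ w) + ε (1 + eᵀw) ^ deg p` over all `w ≥ 0` with `θ w ∈ S`
(`copSup_eq_sInf`). Everything else follows from this formula: the infimum is at least `λ*`; a fixed
`w` contributes a value that tends to `p (θ w)` as `ε → 0`; and if `S` lies in the orthant, then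
passing from `(y, z)` to `(y - z, 0)` does not increase `eᵀy + eᵀz`, so that `z` may be dropped.

One inequality of the formula is the evaluation of the identity at such a `w`. For the other one,
let `f = p ∘ θ - λ + ε (1 + eᵀw) ^ deg p` be positive on the preimage of `S`, let `g_j` be the
constraints `h_1, …, h_m, p - λ_lb` and `d_j` their degrees, and put `d = d_max`. The certificate is
`F (w, u) = (1 + eᵀw) ^ (2 d - deg p) f (w) + M ∑ (1 + eᵀw) ^ (2 (d - d_j)) (g_j (θ w) - u_j) ^ 2`,
summed over the non-constant constraints, for large `M` (`mem_copFeasible_of_pos`). On the graph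
`u = g (θ w)` the squares vanish. Minimizing over `u ≥ 0` replaces `g_j (θ w) - u_j` by the negative
part of `g_j (θ w)`, and after homogenization the claim `F ≥ 0` is that
`f + M ∑ (min g_j 0) ^ 2 ≥ 0` on a compact simplex. A suitable `M` exists if `f` is positive
wherever all `g_j` are non-negative (`exists_penalty`). At points of the simplex that are not at
infinity this is the hypothesis on `f`; at infinity the leading form of `p` is one of the `g_j`,
hence non-negative, and the `ε`-term makes `f` positive.
-/

namespace CopositivePO

open MvPolynomial

/-! ### A penalty argument on compact sets -/

theorem exists_penalty {α ι : Type*} [TopologicalSpace α] [Fintype ι] {K : Set α}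
    (hK : IsCompact K) {f : α → ℝ} {G : ι → α → ℝ} (hf : Continuous f)
    (hG : ∀ j, Continuous (G j)) (hpos : ∀ x ∈ K, (∀ j, 0 ≤ G j x) → 0 < f x) :
    ∃ M : ℝ, 0 ≤ M ∧ ∀ x ∈ K, 0 ≤ f x + M * ∑ j, min (G j x) 0 ^ 2 := by
  have hφ : Continuous fun x => ∑ j, min (G j x) 0 ^ 2 := by fun_prop
  -- Only `x` with `f x ≤ 0` matter. There the penalty has a positive minimum and `f` is bounded
  -- below, so that the quotient of the two minima serves as `M`.
  have hK' : IsCompact (K ∩ {x | f x ≤ 0}) :=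
    hK.inter_right (isClosed_le hf continuous_const)
  rcases (K ∩ {x | f x ≤ 0}).eq_empty_or_nonempty with he | hne
  · refine ⟨0, le_rfl, fun x hx => ?_⟩
    by_contra hlt
    have : x ∈ K ∩ {x | f x ≤ 0} := ⟨hx, by simp at hlt ⊢; exact hlt.le⟩
    simp [he] at this
  · obtain ⟨a, ha, hamin⟩ := hK'.exists_isMinOn hne hφ.continuousOn
    obtain ⟨b, hb, hbmin⟩ := hK'.exists_isMinOn hne hf.continuousOn
    have hapos : 0 < ∑ j, min (G j a) 0 ^ 2 := by
      obtain ⟨j, hj⟩ : ∃ j, G j a < 0 := by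
        by_contra! hcon
        exact absurd (hpos a ha.1 hcon) (not_lt.2 ha.2)
      refine Finset.sum_pos' (fun i _ => sq_nonneg _) ⟨j, Finset.mem_univ j, ?_⟩
      rw [min_eq_left hj.le]
      exact sq_pos_of_neg hj
    have hb0 : f b ≤ 0 := hb.2
    have hM : 0 ≤ -f b / ∑ j, min (G j a) 0 ^ 2 := div_nonneg (by linarith) hapos.le
    refine ⟨_, hM, fun x hx => ?_⟩
    rcases le_total (f x) 0 with hx0 | hx0
    · have h1 := hamin (a := x) ⟨hx, hx0⟩
      have h2 := hbmin (a := x) ⟨hx, hx0⟩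
      simp only [Set.mem_ofPred_eq] at h1 h2
      have h3 := mul_le_mul_of_nonneg_left h1 hM
      rw [div_mul_cancel₀ _ hapos.ne'] at h3
      linarith
    · exact add_nonneg hx0 (mul_nonneg hM (Finset.sum_nonneg fun i _ => sq_nonneg _))

/-! ### Homogenization -/

theorem eval_smul_of_isHomogeneous {τ : Type} {q : MvPolynomial τ ℝ} {k : ℕ}
    (hq : q.IsHomogeneous k) (c : ℝ) (x : τ → ℝ) : eval (c • x) q = c ^ k * eval x q := by
  rw [eval_eq, eval_eq, Finset.mul_sum]
  refine Finset.sum_congr rfl fun s hs => ?_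
  have hdeg : ∑ i ∈ s.support, s i = k := by
    simpa [Finsupp.weight_apply, Finsupp.sum] using hq (mem_support_iff.1 hs)
  simp only [Pi.smul_apply, smul_eq_mul, mul_pow, Finset.prod_mul_distrib]
  rw [Finset.prod_pow_eq_pow_sum, hdeg]
  ring

/-- The value at `(t, x)` of the homogenization of `q` to degree `d`, with `t` as the additional
variable: `t ^ d * q (x / t)` for `t ≠ 0` and `q.totalDegree ≤ d`. Components of `q` of degree
greater than `d` are discarded. -/
noncomputable def homogEval {τ : Type} (d : ℕ) (q : MvPolynomial τ ℝ) (t : ℝ) (x : τ → ℝ) : ℝ :=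
  ∑ i ∈ Finset.range (d + 1), t ^ (d - i) * eval x (homogeneousComponent i q)

section homogEval

variable {τ : Type} {d : ℕ} {q : MvPolynomial τ ℝ}

theorem homogEval_one (hq : q.totalDegree ≤ d) (x : τ → ℝ) : homogEval d q 1 x = eval x q := by
  conv_rhs => rw [← sum_homogeneousComponent q]
  rw [map_sum]
  simp only [homogEval, one_pow, one_mul]
  symm
  refine Finset.sum_subset (Finset.range_mono (by omega)) fun i _ hi => ?_
  rw [homogeneousComponent_eq_zero _ _ (by simpa [Nat.lt_succ_iff] using hi), map_zero]

theorem homogEval_smul (c t : ℝ) (x : τ → ℝ) :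
    homogEval d q (c * t) (c • x) = c ^ d * homogEval d q t x := by
  rw [homogEval, homogEval, Finset.mul_sum]
  refine Finset.sum_congr rfl fun i hi => ?_
  have hid : i ≤ d := Nat.lt_succ_iff.1 (Finset.mem_range.1 hi)
  rw [eval_smul_of_isHomogeneous (homogeneousComponent_isHomogeneous i q), mul_pow]
  calc c ^ (d - i) * t ^ (d - i) * (c ^ i * eval x (homogeneousComponent i q))
      = (c ^ (d - i) * c ^ i) * (t ^ (d - i) * eval x (homogeneousComponent i q)) := by ring
    _ = _ := by rw [← pow_add, Nat.sub_add_cancel hid]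

theorem homogEval_zero (x : τ → ℝ) :
    homogEval d q 0 x = eval x (homogeneousComponent d q) := by
  rw [homogEval, Finset.sum_range_succ, Finset.sum_eq_zero, Nat.sub_self]
  · simp
  · intro i hi
    rw [zero_pow (by have := Finset.mem_range.1 hi; omega), zero_mul]

theorem continuous_homogEval {α : Type*} [TopologicalSpace α] {t : α → ℝ} {x : α → τ → ℝ}
    (ht : Continuous t) (hx : Continuous x) :
    Continuous fun a => homogEval d q (t a) (x a) := by
  unfold homogEval
  exact continuous_finsetSum _ fun i _ =>
    (ht.pow _).mul ((MvPolynomial.continuous_eval _).comp hx)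

end homogEval

/-! ### Degrees and substitution -/

theorem totalDegree_bind₁_le {τ σ : Type} {θ : τ → MvPolynomial σ ℝ}
    (hθ : ∀ i, (θ i).totalDegree ≤ 1) (q : MvPolynomial τ ℝ) :
    (bind₁ θ q).totalDegree ≤ q.totalDegree := by
  conv_lhs => rw [q.as_sum, map_sum]
  refine totalDegree_finsetSum_le fun s hs => ?_
  rw [bind₁_monomial]
  refine (totalDegree_mul _ _).trans ?_
  rw [totalDegree_C, zero_add]
  refine (totalDegree_finsetProd _ _).trans (le_trans ?_ (le_totalDegree hs))
  refine Finset.sum_le_sum fun i _ => (totalDegree_pow _ _).trans ?_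
  simpa using Nat.mul_le_mul_left (s i) (hθ i)

theorem eval_bind₁ {τ σ : Type} (θ : τ → MvPolynomial σ ℝ) (q : MvPolynomial τ ℝ) (w : σ → ℝ) :
    eval w (bind₁ θ q) = eval (fun i => eval w (θ i)) q :=
  eval₂Hom_bind₁ (RingHom.id ℝ) w θ q

theorem eval_onePlusSum {σ : Type} [Fintype σ] (w : σ → ℝ) :
    eval w (onePlusSum σ) = 1 + ∑ i, w i := by
  simp [onePlusSum]

theorem totalDegree_onePlusSum_le (σ : Type) [Fintype σ] : (onePlusSum σ).totalDegree ≤ 1 := by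
  refine (totalDegree_add _ _).trans (max_le (by simp) ?_)
  exact totalDegree_finsetSum_le fun i _ => (totalDegree_X i).le

theorem totalDegree_pow_le_of_le_one {σ : Type} {q : MvPolynomial σ ℝ} (hq : q.totalDegree ≤ 1)
    (k : ℕ) : (q ^ k).totalDegree ≤ k :=
  (totalDegree_pow _ _).trans (by simpa using Nat.mul_le_mul_left k hq)

section CopositiveProgram

variable {n m : ℕ} {σ : Type} [Fintype σ] {θ : Fin n → MvPolynomial σ ℝ}
  {h : Fin m → MvPolynomial (Fin n) ℝ} {p : MvPolynomial (Fin n) ℝ} {lb ε l : ℝ}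

/-- The degrees `deg h_1, …, deg h_m, deg p` that bound those of `extConstraints`. -/
noncomputable def extDegrees (h : Fin m → MvPolynomial (Fin n) ℝ) (p : MvPolynomial (Fin n) ℝ) :
    Fin (m + 1) → ℕ :=
  Fin.snoc (fun j => (h j).totalDegree) p.totalDegree

theorem extDegrees_le_dMax (j : Fin (m + 1)) : extDegrees h p j ≤ dMax h p := by
  induction j using Fin.lastCases with
  | last => simp [extDegrees, dMax]
  | cast j =>
    rw [extDegrees, Fin.snoc_castSucc]
    exact (Finset.le_sup (f := fun j => (h j).totalDegree) (Finset.mem_univ j)).trans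
      (le_max_left _ _)

theorem totalDegree_extConstraints_le (j : Fin (m + 1)) :
    (extConstraints h p lb j).totalDegree ≤ extDegrees h p j := by
  induction j using Fin.lastCases with
  | last => simpa [extDegrees, extConstraints] using totalDegree_sub_C_le p lb
  | cast j => simp [extDegrees, extConstraints]

/-- The points `w ≥ 0` with `θ w ∈ S`. -/
def liftedSet (θ : Fin n → MvPolynomial σ ℝ) (h : Fin m → MvPolynomial (Fin n) ℝ) :
    Set (σ → ℝ) :=
  {w | w ∈ orthant σ ∧ (fun i => eval w (θ i)) ∈ semialgSet h}

/-- The perturbed objective `p (θ w) + ε (1 + eᵀw) ^ deg p`. -/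
noncomputable def perturbedObj (θ : Fin n → MvPolynomial σ ℝ) (p : MvPolynomial (Fin n) ℝ) (ε : ℝ)
    (w : σ → ℝ) : ℝ :=
  eval (fun i => eval w (θ i)) p + ε * (1 + ∑ i, w i) ^ p.totalDegree

theorem lb_le_of_mem (hlb : (lb : EReal) ≤ optValue h p) {x : Fin n → ℝ} (hx : x ∈ semialgSet h) :
    lb ≤ eval x p :=
  EReal.coe_le_coe_iff.1 (hlb.trans (sInf_le ⟨x, hx, rfl⟩))

theorem extConstraints_nonneg (hlb : (lb : EReal) ≤ optValue h p) {x : Fin n → ℝ}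
    (hx : x ∈ semialgSet h) (j : Fin (m + 1)) : 0 ≤ eval x (extConstraints h p lb j) := by
  induction j using Fin.lastCases with
  | last => simpa [extConstraints] using lb_le_of_mem hlb hx
  | cast j => simpa [extConstraints] using hx j

theorem le_perturbedObj_of_mem_copFeasible (hlb : (lb : EReal) ≤ optValue h p)
    (hl : l ∈ copFeasible θ h p lb ε) {w : σ → ℝ} (hw : w ∈ liftedSet θ h) :
    l ≤ perturbedObj θ p ε w := by
  obtain ⟨F, ⟨-, hF⟩, hFeq⟩ := hl
  have hs : 0 < 1 + ∑ i, w i :=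
    add_pos_of_pos_of_nonneg one_pos (Finset.sum_nonneg fun i _ => hw.1 i)
  have hev := congrArg (eval w) hFeq
  rw [eval_bind₁] at hev
  simp only [map_mul, map_pow, map_add, map_sub, eval_C, eval_onePlusSum, eval_bind₁] at hev
  have h0 : 0 ≤ eval (fun i => eval w (Sum.elim X
      (fun j => bind₁ θ (extConstraints h p lb j)) i)) F := by
    refine hF _ ?_
    rintro (i | j)
    · simpa using hw.1 i
    · simpa [eval_bind₁] using extConstraints_nonneg hlb hw.2 j
  rw [← hev] at h0
  have := nonneg_of_mul_nonneg_right h0 (pow_pos hs _)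
  rw [perturbedObj]
  linarith

/-! ### The copositive certificate -/

/-- The polynomial `(1 + eᵀw) ^ (2 d - deg p) (p (θ w) - l + ε (1 + eᵀw) ^ deg p)
+ M ∑ (1 + eᵀw) ^ (2 (d - d_j)) (g_j (θ w) - u_j) ^ 2` in the variables `(w, u)`, where `d = dMax h p`
and `g = extConstraints h p lb` has the degree bounds `d_j`. Terms with `d_j = 0` are left out: the
variable `u_j` would make their degree exceed `2 d`. -/
noncomputable def certificate (θ : Fin n → MvPolynomial σ ℝ) (h : Fin m → MvPolynomial (Fin n) ℝ)
    (p : MvPolynomial (Fin n) ℝ) (lb ε l M : ℝ) : MvPolynomial (σ ⊕ Fin (m + 1)) ℝ :=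
  rename Sum.inl (onePlusSum σ ^ (2 * dMax h p - p.totalDegree) *
    (bind₁ θ p - C l + C ε * onePlusSum σ ^ p.totalDegree)) +
  C M * ∑ j, if extDegrees h p j = 0 then 0 else
    rename Sum.inl (onePlusSum σ) ^ (2 * (dMax h p - extDegrees h p j)) *
      (rename Sum.inl (bind₁ θ (extConstraints h p lb j)) - X (Sum.inr j)) ^ 2

theorem bind₁_certificate (M : ℝ) :
    bind₁ (Sum.elim X fun j => bind₁ θ (extConstraints h p lb j)) (certificate θ h p lb ε l M) =
      onePlusSum σ ^ (2 * dMax h p - p.totalDegree) *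
        (bind₁ θ p - C l + C ε * onePlusSum σ ^ p.totalDegree) := by
  have hren : ∀ q : MvPolynomial σ ℝ,
      bind₁ (Sum.elim X fun j => bind₁ θ (extConstraints h p lb j)) (rename Sum.inl q) = q := by
    intro q
    rw [bind₁_rename, Sum.elim_comp_inl, bind₁_X_left, AlgHom.id_apply]
  rw [certificate, map_add, hren, map_mul, map_sum, Finset.sum_eq_zero, mul_zero, add_zero]
  intro j _
  split_ifs
  · exact map_zero _
  · rw [map_mul, map_pow _ _ 2, map_sub, hren, bind₁_X_right, Sum.elim_inr, sub_self,
      zero_pow two_ne_zero, mul_zero]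

theorem totalDegree_certificate_le (hθ : ∀ i, (θ i).IsHomogeneous 1) (M : ℝ) :
    (certificate θ h p lb ε l M).totalDegree ≤ 2 * dMax h p := by
  have hp : p.totalDegree ≤ dMax h p := le_max_right _ _
  have hE := totalDegree_onePlusSum_le σ
  have hb : ∀ q : MvPolynomial (Fin n) ℝ, (bind₁ θ q).totalDegree ≤ q.totalDegree :=
    totalDegree_bind₁_le fun i => (hθ i).totalDegree_le
  refine (totalDegree_add _ _).trans (max_le ?_ ?_)
  · refine (totalDegree_rename_le _ _).trans ((totalDegree_mul _ _).trans ?_)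
    have h1 := totalDegree_pow_le_of_le_one hE (2 * dMax h p - p.totalDegree)
    have h2 : (bind₁ θ p - C l + C ε * onePlusSum σ ^ p.totalDegree).totalDegree ≤
        p.totalDegree := by
      refine (totalDegree_add _ _).trans (max_le ((totalDegree_sub_C_le _ _).trans (hb p)) ?_)
      refine (totalDegree_mul _ _).trans ?_
      rw [totalDegree_C, zero_add]
      exact totalDegree_pow_le_of_le_one hE _
    omega
  · refine (totalDegree_mul _ _).trans ?_
    rw [totalDegree_C, zero_add]
    refine totalDegree_finsetSum_le fun j _ => ?_
    split_ifs with hj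
    · simp
    · have hjd := extDegrees_le_dMax (h := h) (p := p) j
      refine (totalDegree_mul _ _).trans ?_
      have h1 := totalDegree_pow_le_of_le_one
        ((totalDegree_rename_le (Sum.inl : σ → σ ⊕ Fin (m + 1)) _).trans hE)
        (2 * (dMax h p - extDegrees h p j))
      have h2 : (rename (Sum.inl : σ → σ ⊕ Fin (m + 1)) (bind₁ θ (extConstraints h p lb j)) -
          X (Sum.inr j)).totalDegree ≤ extDegrees h p j := by
        refine (totalDegree_sub _ _).trans (max_le ?_ ?_)
        · exact (totalDegree_rename_le _ _).trans
            ((hb _).trans (totalDegree_extConstraints_le j))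
        · rw [totalDegree_X]
          omega
      have h3 := (totalDegree_pow (rename (Sum.inl : σ → σ ⊕ Fin (m + 1))
        (bind₁ θ (extConstraints h p lb j)) - X (Sum.inr j)) 2).trans
          (Nat.mul_le_mul_left 2 h2)
      omega

/-- On the simplex `t + eᵀw = 1` the homogenization of the perturbed `p ∘ θ - l` is positive wherever
the homogenized constraints are non-negative. For `t > 0` this is the assumption at `w / t`. For
`t = 0` the last constraint is the leading form of `p`, and `ε` remains. -/
theorem homogenized_pos (hθ : ∀ i, (θ i).IsHomogeneous 1) (hε : 0 < ε)
    (hne : (liftedSet θ h).Nonempty) (hl : ∀ w ∈ liftedSet θ h, l < perturbedObj θ p ε w)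
    {t : ℝ} {w : σ → ℝ} (ht : 0 ≤ t) (hw : w ∈ orthant σ) (htw : t + ∑ i, w i = 1)
    (hG : ∀ j, 0 ≤ homogEval (extDegrees h p j) (extConstraints h p lb j) t
      (fun i => eval w (θ i))) :
    0 < homogEval p.totalDegree p t (fun i => eval w (θ i)) - l * t ^ p.totalDegree + ε := by
  rcases ht.eq_or_lt with rfl | ht
  · rcases Nat.eq_zero_or_pos p.totalDegree with hp | hp
    -- A constant `p` has no point at infinity to look at: its value is that at any lifted point.
    · obtain ⟨v, hv⟩ := hne
      have h1 := hl v hv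
      obtain ⟨c, rfl⟩ : ∃ c, p = C c := ⟨_, totalDegree_eq_zero_iff_eq_C.1 hp⟩
      simp only [perturbedObj, eval_C, totalDegree_C, pow_zero, mul_one] at h1
      simp only [totalDegree_C, homogEval_zero, homogeneousComponent_zero, coeff_C, if_true,
        eval_C, pow_zero, mul_one]
      linarith
    · have h1 := hG (Fin.last m)
      simp only [extDegrees, extConstraints, Fin.snoc_last, homogEval_zero] at h1
      rw [map_sub, homogeneousComponent_of_mem (isHomogeneous_C (Fin n) lb), if_neg hp.ne',
        sub_zero] at h1
      rw [homogEval_zero, zero_pow hp.ne']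
      linarith
  · have hscale : ∀ (d : ℕ) (q : MvPolynomial (Fin n) ℝ), q.totalDegree ≤ d →
        homogEval d q t (fun i => eval w (θ i)) =
          t ^ d * eval (fun i => eval (t⁻¹ • w) (θ i)) q := by
      intro d q hq
      rw [← homogEval_one hq, ← homogEval_smul, mul_one]
      congr 1
      ext i
      rw [Pi.smul_apply, smul_eq_mul, eval_smul_of_isHomogeneous (hθ i), pow_one,
        mul_inv_cancel_left₀ ht.ne']
    have hmem : t⁻¹ • w ∈ liftedSet θ h := by
      refine ⟨fun i => mul_nonneg (inv_nonneg.2 ht.le) (hw i), fun j => ?_⟩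
      have h1 := hG j.castSucc
      rw [hscale _ _ (totalDegree_extConstraints_le _)] at h1
      simpa [extConstraints] using nonneg_of_mul_nonneg_right h1 (pow_pos ht _)
    have h1 := hl _ hmem
    have hsum : 1 + ∑ i, (t⁻¹ • w) i = t⁻¹ := by
      simp only [Pi.smul_apply, smul_eq_mul, ← Finset.mul_sum]
      rw [eq_sub_of_add_eq' htw]
      field_simp
      ring
    rw [perturbedObj, hsum] at h1
    rw [hscale _ _ le_rfl]
    have h2 := mul_lt_mul_of_pos_left h1 (pow_pos ht p.totalDegree)
    have h3 : t ^ p.totalDegree * (ε * t⁻¹ ^ p.totalDegree) = ε := by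
      rw [inv_pow]
      field_simp
    rw [mul_add, h3] at h2
    linarith

/-- The penalty weight for the simplex makes the certificate copositive: with `s = 1 + eᵀw`, its value
at `(w, u)` is at least `s ^ (2 * dMax h p)` times the penalized function at `(1 / s, w / s)`. -/
theorem mem_copFeasible_of_pos (hθ : ∀ i, (θ i).IsHomogeneous 1) (hε : 0 < ε)
    (hlb : (lb : EReal) ≤ optValue h p)
    (hne : (liftedSet θ h).Nonempty) (hl : ∀ w ∈ liftedSet θ h, l < perturbedObj θ p ε w) :
    l ∈ copFeasible θ h p lb ε := by
  have hL : Continuous fun a : ℝ × (σ → ℝ) => fun i => eval a.2 (θ i) :=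
    continuous_pi fun i => (MvPolynomial.continuous_eval _).comp continuous_snd
  have hK : IsCompact {a : ℝ × (σ → ℝ) | (0 ≤ a.1 ∧ a.2 ∈ orthant σ) ∧ a.1 + ∑ i, a.2 i = 1} := by
    refine (isCompact_Icc (a := ((0, 0) : ℝ × (σ → ℝ))) (b := (1, 1))).of_isClosed_subset ?_ ?_
    · refine (IsClosed.and ?_ ?_).and ?_
      · exact isClosed_le continuous_const continuous_fst
      · exact isClosed_le continuous_const continuous_snd
      · exact isClosed_eq (by fun_prop) continuous_const
    · rintro ⟨t, w⟩ ⟨⟨ht, hw⟩, htw⟩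
      have hs : ∀ i, w i ≤ ∑ i, w i := fun i =>
        Finset.single_le_sum (fun k _ => hw k) (Finset.mem_univ i)
      have hs0 : 0 ≤ ∑ i, w i := Finset.sum_nonneg fun k _ => hw k
      simp only at ht htw
      exact ⟨⟨ht, hw⟩, ⟨by simp only; linarith, fun i => by
        have := hs i
        simp only [Pi.one_apply]
        linarith⟩⟩
  obtain ⟨M, hM, hMK⟩ := exists_penalty hK
    (f := fun a => homogEval p.totalDegree p a.1 (fun i => eval a.2 (θ i)) -
      l * a.1 ^ p.totalDegree + ε)
    (G := fun j a => homogEval (extDegrees h p j) (extConstraints h p lb j) a.1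
      (fun i => eval a.2 (θ i)))
    (((continuous_homogEval continuous_fst hL).sub (by fun_prop)).add continuous_const)
    (fun j => continuous_homogEval continuous_fst hL)
    (fun a ha hG => homogenized_pos hθ hε hne hl ha.1.1 ha.1.2 ha.2 hG)
  refine ⟨certificate θ h p lb ε l M, ⟨totalDegree_certificate_le hθ M, fun v hv => ?_⟩,
    (bind₁_certificate M).symm⟩
  have hpD : p.totalDegree ≤ dMax h p := le_max_right _ _
  obtain ⟨w, hwdef⟩ : ∃ w : σ → ℝ, w = v ∘ Sum.inl := ⟨_, rfl⟩
  have hw : w ∈ orthant σ := fun i => by rw [hwdef]; exact hv (Sum.inl i)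
  obtain ⟨s, hsdef⟩ : ∃ s : ℝ, s = 1 + ∑ i, w i := ⟨_, rfl⟩
  have hs : 0 < s := by
    rw [hsdef]
    exact add_pos_of_pos_of_nonneg one_pos (Finset.sum_nonneg fun i _ => hw i)
  have hscale : ∀ (d : ℕ) (q : MvPolynomial (Fin n) ℝ), q.totalDegree ≤ d →
      eval (fun i => eval w (θ i)) q =
        s ^ d * homogEval d q s⁻¹ (fun i => eval (s⁻¹ • w) (θ i)) := by
    intro d q hq
    rw [← homogEval_one hq, ← homogEval_smul, mul_inv_cancel₀ hs.ne']
    congr 1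
    ext i
    rw [Pi.smul_apply, smul_eq_mul, eval_smul_of_isHomogeneous (hθ i), pow_one,
      mul_inv_cancel_left₀ hs.ne']
  have hineq := hMK (s⁻¹, s⁻¹ • w) ⟨⟨inv_nonneg.2 hs.le, fun i =>
    mul_nonneg (inv_nonneg.2 hs.le) (hw i)⟩, by
      simp only [Pi.smul_apply, smul_eq_mul, ← Finset.mul_sum]
      rw [← mul_one_add, ← hsdef, inv_mul_cancel₀ hs.ne']⟩
  have hev : eval v (certificate θ h p lb ε l M) =
      s ^ (2 * dMax h p - p.totalDegree) * (eval (fun i => eval w (θ i)) p - l +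
        ε * s ^ p.totalDegree) +
      M * ∑ j, if extDegrees h p j = 0 then 0 else s ^ (2 * (dMax h p - extDegrees h p j)) *
        (eval (fun i => eval w (θ i)) (extConstraints h p lb j) - v (Sum.inr j)) ^ 2 := by
    simp only [certificate, map_add, map_mul, map_sum, map_pow, map_sub, eval_C, apply_ite (eval v),
      map_zero, eval_X, eval_rename, eval_bind₁, eval_onePlusSum, ← hwdef, ← hsdef]
  rw [hev]
  refine (mul_nonneg (pow_nonneg hs.le (2 * dMax h p)) hineq).trans ?_
  rw [mul_add]
  refine add_le_add (le_of_eq ?_) ?_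
  · rw [hscale _ p le_rfl]
    obtain ⟨k, hk⟩ : ∃ k, 2 * dMax h p = k + p.totalDegree :=
      ⟨2 * dMax h p - p.totalDegree, by omega⟩
    rw [hk, Nat.add_sub_cancel, pow_add, inv_pow]
    field_simp
  · rw [mul_left_comm]
    refine mul_le_mul_of_nonneg_left ?_ hM
    rw [Finset.mul_sum]
    refine Finset.sum_le_sum fun j _ => ?_
    have hjd := extDegrees_le_dMax (h := h) (p := p) j
    have hg := hscale _ _ (totalDegree_extConstraints_le (lb := lb) (h := h) (p := p) j)
    split_ifs with hj
    -- A constant constraint is non-negative everywhere because it is so at a lifted point.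
    · obtain ⟨x, hx⟩ := hne
      have hc := totalDegree_extConstraints_le (lb := lb) (h := h) (p := p) j
      rw [hj, Nat.le_zero, totalDegree_eq_zero_iff_eq_C] at hc
      have h1 := extConstraints_nonneg hlb hx.2 j
      rw [hj, pow_zero, one_mul] at hg
      rw [hj, min_eq_right, zero_pow two_ne_zero, mul_zero]
      rw [← hg]
      rw [hc, eval_C] at h1 ⊢
      exact h1
    · rw [hg]
      have hsplit : s ^ (2 * dMax h p) =
          s ^ (2 * (dMax h p - extDegrees h p j)) * (s ^ extDegrees h p j) ^ 2 := by
        rw [← pow_mul, ← pow_add]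
        congr 1
        omega
      rw [hsplit, mul_assoc]
      refine mul_le_mul_of_nonneg_left ?_ (pow_nonneg hs.le _)
      -- For `u ≥ 0` the distance from `g` to `u` is at least the negative part of `g`.
      rw [← mul_pow, mul_min_of_nonneg _ _ (pow_nonneg hs.le _), mul_zero, sq_le_sq]
      have hu : 0 ≤ v (Sum.inr j) := hv (Sum.inr j)
      rw [abs_of_nonpos (min_le_right _ _)]
      rcases le_total (s ^ extDegrees h p j * homogEval (extDegrees h p j)
        (extConstraints h p lb j) s⁻¹ (fun i => eval (s⁻¹ • w) (θ i))) 0 with h0 | h0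
      · rw [min_eq_left h0]
        exact le_trans (by linarith) (neg_le_abs _)
      · rw [min_eq_right h0, neg_zero]
        exact abs_nonneg _

/-! ### The value of the program -/

theorem copSup_eq_sInf (hθ : ∀ i, (θ i).IsHomogeneous 1) (hε : 0 < ε)
    (hlb : (lb : EReal) ≤ optValue h p) (hne : (liftedSet θ h).Nonempty) :
    copSup θ h p lb ε =
      sInf ((fun w => ((perturbedObj θ p ε w : ℝ) : EReal)) '' liftedSet θ h) := by
  refine le_antisymm (sSup_le ?_) (EReal.ge_of_forall_gt_iff_ge.1 fun l hl => ?_)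
  · rintro _ ⟨l, hl, rfl⟩
    refine le_sInf ?_
    rintro _ ⟨w, hw, rfl⟩
    exact EReal.coe_le_coe_iff.2 (le_perturbedObj_of_mem_copFeasible hlb hl hw)
  · refine le_sSup ⟨l, mem_copFeasible_of_pos hθ hε hlb hne fun w hw => ?_, rfl⟩
    exact EReal.coe_lt_coe_iff.1 (hl.trans_le (sInf_le ⟨w, hw, rfl⟩))

theorem optValue_le_copSup (hθ : ∀ i, (θ i).IsHomogeneous 1) (hε : 0 < ε)
    (hlb : (lb : EReal) ≤ optValue h p) (hne : (liftedSet θ h).Nonempty) :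
    optValue h p ≤ copSup θ h p lb ε := by
  rw [copSup_eq_sInf hθ hε hlb hne]
  refine le_sInf ?_
  rintro _ ⟨w, hw, rfl⟩
  have hx : optValue h p ≤ (eval (fun i => eval w (θ i)) p : ℝ) := sInf_le ⟨_, hw.2, rfl⟩
  refine hx.trans (EReal.coe_le_coe_iff.2 ?_)
  have hs : 0 ≤ 1 + ∑ i, w i :=
    add_nonneg zero_le_one (Finset.sum_nonneg fun i _ => hw.1 i)
  exact le_add_of_nonneg_right (mul_nonneg hε.le (pow_nonneg hs _))

theorem tendsto_copSup (hθ : ∀ i, (θ i).IsHomogeneous 1)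
    (hlb : (lb : EReal) ≤ optValue h p) (hne : (liftedSet θ h).Nonempty)
    (hsurj : ∀ x ∈ semialgSet h, ∃ w ∈ orthant σ, (fun i => eval w (θ i)) = x) :
    Tendsto (fun ε : ℝ => copSup θ h p lb ε) (𝓝[>] 0) (𝓝 (optValue h p)) := by
  refine tendsto_order.2 ⟨fun a ha => ?_, fun a ha => ?_⟩
  · filter_upwards [self_mem_nhdsWithin] with ε hε
    exact ha.trans_le (optValue_le_copSup hθ hε hlb hne)
  · obtain ⟨_, ⟨x, hx, rfl⟩, hxa⟩ := sInf_lt_iff.1 ha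
    obtain ⟨w, hw, rfl⟩ := hsurj x hx
    have hlim : Tendsto (fun ε : ℝ => ((perturbedObj θ p ε w : ℝ) : EReal)) (𝓝[>] 0)
        (𝓝 ((eval (fun i => eval w (θ i)) p : ℝ) : EReal)) := by
      refine (continuous_coe_real_ereal.tendsto _).comp (tendsto_nhdsWithin_of_tendsto_nhds ?_)
      have hc : Continuous fun ε : ℝ => perturbedObj θ p ε w := by
        unfold perturbedObj
        fun_prop
      simpa [perturbedObj] using hc.tendsto 0
    filter_upwards [self_mem_nhdsWithin, hlim.eventually_lt_const hxa] with ε hε hlt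
    rw [copSup_eq_sInf hθ hε hlb hne]
    exact lt_of_le_of_lt (sInf_le ⟨w, ⟨hw, hx⟩, rfl⟩) hlt

end CopositiveProgram

/-! ### Eliminating `z` -/

section Elimination

variable {n m : ℕ} {h : Fin m → MvPolynomial (Fin n) ℝ} {p : MvPolynomial (Fin n) ℝ} {lb ε : ℝ}

theorem isHomogeneous_X_sub_X (i : Fin n) :
    (X (Sum.inl i) - X (Sum.inr i) : MvPolynomial (Fin n ⊕ Fin n) ℝ).IsHomogeneous 1 :=
  (isHomogeneous_X ℝ _).sub (isHomogeneous_X ℝ _)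

theorem exists_orthant_sub_eq (x : Fin n → ℝ) : ∃ w ∈ orthant (Fin n ⊕ Fin n),
    (fun i => eval w (X (Sum.inl i) - X (Sum.inr i) : MvPolynomial (Fin n ⊕ Fin n) ℝ)) = x := by
  refine ⟨Sum.elim (fun i => (x i)⁺) (fun i => (x i)⁻), ?_, ?_⟩
  · rintro (i | i)
    · exact posPart_nonneg _
    · exact negPart_nonneg _
  · ext i
    simp [posPart_sub_negPart]

theorem liftedSet_X_sub_X_nonempty (hS : (semialgSet h).Nonempty) :
    (liftedSet (σ := Fin n ⊕ Fin n) (fun i => X (Sum.inl i) - X (Sum.inr i)) h).Nonempty := by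
  obtain ⟨x, hx⟩ := hS
  obtain ⟨w, hw, rfl⟩ := exists_orthant_sub_eq x
  exact ⟨w, hw, hx⟩

theorem liftedSet_X_nonempty (hS : (semialgSet h).Nonempty)
    (hSo : semialgSet h ⊆ orthant (Fin n)) :
    (liftedSet (σ := Fin n) (fun i => X i) h).Nonempty := by
  obtain ⟨x, hx⟩ := hS
  exact ⟨x, hSo hx, by simpa using hx⟩

theorem copValueNoZ_eq_copValue (hS : (semialgSet h).Nonempty)
    (hSo : semialgSet h ⊆ orthant (Fin n)) (hlb : (lb : EReal) ≤ optValue h p) (hε : 0 < ε) :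
    copValueNoZ h p lb ε = copValue h p lb ε := by
  rw [copValueNoZ, copValue, copSup_eq_sInf (fun i => isHomogeneous_X ℝ i) hε hlb
    (liftedSet_X_nonempty hS hSo), copSup_eq_sInf isHomogeneous_X_sub_X hε hlb
    (liftedSet_X_sub_X_nonempty hS)]
  refine le_antisymm (le_sInf ?_) (le_sInf ?_)
  · rintro _ ⟨w, hw, rfl⟩
    have hx : (fun i => w (Sum.inl i) - w (Sum.inr i)) ∈ semialgSet h := by simpa using hw.2
    refine le_trans (sInf_le ⟨_, ⟨hSo hx, by simpa using hx⟩, rfl⟩) (EReal.coe_le_coe_iff.2 ?_)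
    simp only [perturbedObj, eval_X, map_sub, Fintype.sum_sum_type, Finset.sum_sub_distrib]
    have hz : 0 ≤ ∑ i, w (Sum.inr i) := Finset.sum_nonneg fun i _ => hw.1 _
    have h0 : 0 ≤ ∑ i, (w (Sum.inl i) - w (Sum.inr i)) := Finset.sum_nonneg fun i _ => hSo hx i
    rw [Finset.sum_sub_distrib] at h0
    gcongr
    · linarith
  · rintro _ ⟨y, hy, rfl⟩
    have hx : y ∈ semialgSet h := by simpa using hy.2
    refine sInf_le ⟨Sum.elim y 0, ⟨?_, by simpa using hx⟩, ?_⟩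
    · rintro (i | i)
      · exact hy.1 i
      · exact le_rfl
    · simp [perturbedObj]

end Elimination

end CopositivePO

theorem proposition5p3 {n m : ℕ} (h : Fin m → MvPolynomial (Fin n) ℝ)
    (p : MvPolynomial (Fin n) ℝ) (hS : (CopositivePO.semialgSet h).Nonempty)
    (lb : ℝ) (hlb : (lb : EReal) ≤ CopositivePO.optValue h p) :
    (∀ ε : ℝ, 0 < ε → CopositivePO.optValue h p ≤ CopositivePO.copValue h p lb ε) ∧
    Tendsto (fun ε : ℝ => CopositivePO.copValue h p lb ε) (𝓝[>] 0)
      (𝓝 (CopositivePO.optValue h p)) ∧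
    (CopositivePO.semialgSet h ⊆ CopositivePO.orthant (Fin n) →
      (∀ ε : ℝ, 0 < ε →
        CopositivePO.copValueNoZ h p lb ε = CopositivePO.copValue h p lb ε) ∧
      (∀ ε : ℝ, 0 < ε → CopositivePO.optValue h p ≤ CopositivePO.copValueNoZ h p lb ε) ∧
      Tendsto (fun ε : ℝ => CopositivePO.copValueNoZ h p lb ε) (𝓝[>] 0)
        (𝓝 (CopositivePO.optValue h p))) := by
  open CopositivePO in
  refine ⟨fun ε hε => optValue_le_copSup isHomogeneous_X_sub_X hε hlb
      (liftedSet_X_sub_X_nonempty hS),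
    tendsto_copSup isHomogeneous_X_sub_X hlb (liftedSet_X_sub_X_nonempty hS)
      fun x _ => exists_orthant_sub_eq x,
    fun hSo => ⟨fun ε hε => copValueNoZ_eq_copValue hS hSo hlb hε,
      fun ε hε => optValue_le_copSup (fun i => MvPolynomial.isHomogeneous_X ℝ i) hε hlb
        (liftedSet_X_nonempty hS hSo),
      tendsto_copSup (fun i => MvPolynomial.isHomogeneous_X ℝ i) hlb
        (liftedSet_X_nonempty hS hSo) fun x hx => ⟨x, hSo hx, by simp⟩⟩⟩
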